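/- Let $n\ge 1$ be an integer, $a\in(-1,1)$, $R>0$, and let $$\mathcal C_{R,1}=\{(x,y)\in\mathbb R^n\times\mathbb R:\ |x|<R,\ 0<y<1\}.$$ Let $u\in C(\overline{\mathcal C_{R,1}})\cap H^1(\mathcal C_{R,1},y^a)$, that is, $u$ is continuous on the closed cylinder, has a weak gradient $\nabla u$ in $\mathcal C_{R,1}$, and $\int_{\mathcal C_{R,1}}y^a(u^2+|\nabla u|^2)\,dx\,dy<\infty$. Assume that - $L_a u:=\operatorname{div}(y^a\nabla u)\le 0$ in $\mathcal C_{R,1}$ in the weak sense, i.e. $\int_{\mathcal C_{R,1}}y^a\,\nabla u\cdot\nabla\xi\,dx\,dy\ge 0$ for every nonnegative $\xi\in C_c^\infty(\mathcal C_{R,1})$; - $u>0$ in $\mathcal C_{R,1}$; - $u(0,0)=0$. Then $$\limsup_{y\to0^+}\Bigl(-y^a\,\frac{u(0,y)}{y}\Bigr)<0,$$ where the upper limit is taken in $[-\infty,+\infty]$ (and may be $-\infty$). If, in addition, $y^a u_y\in C(\overline{\mathcal C_{R,1}})$, i.e. $y^a u_y$ (with $u_y$ the weak $y$-derivative of $u$)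 coincides a.e. in $\mathcal C_{R,1}$ with a function $g$ continuous on $\overline{\mathcal C_{R,1}}$, then $u(0,\cdot)$ is differentiable at every sufficiently small $y>0$, the conormal derivative $$\partial_{\nu^a}u(0,0):=-\lim_{y\to0^+}y^a\,u_y(0,y)$$ exists and equals $-g(0,0)$, and $$\partial_{\nu^a}u(0,0)<0.$$ -/

import Mathlib

open Set Filter Topology MeasureTheory
open scoped ContDiff

/-- A point `p = (x, y)` of `ℝⁿ⁺¹ = ℝⁿ × ℝ`; here `p.1 = x` carries the Euclidean norm of `ℝⁿ`,
the extension variable is `p.2 = y`, and `volume` is the Lebesgue measure `dx dy`. -/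
abbrev ExtSpace (n : ℕ) : Type := EuclideanSpace ℝ (Fin n) × ℝ

/-- The cylinder `𝒞_{R,1} = {|x| < R} × (0, 1)`. -/
def unitCylinder (n : ℕ) (R : ℝ) : Set (ExtSpace n) :=
  Metric.ball (0 : EuclideanSpace ℝ (Fin n)) R ×ˢ Ioo (0 : ℝ) 1

/-- The Euclidean inner product of two vectors of `ℝⁿ × ℝ`. -/
noncomputable def dotExt {n : ℕ} (v w : ExtSpace n) : ℝ := inner ℝ v.1 w.1 + v.2 * w.2

/-- The test functions on `Ω`: smooth, with compact support contained in `Ω`. -/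
structure IsTestFunction {n : ℕ} (Ω : Set (ExtSpace n)) (ξ : ExtSpace n → ℝ) : Prop where
  contDiff : ContDiff ℝ ∞ ξ
  hasCompactSupport : HasCompactSupport ξ
  tsupport_subset : tsupport ξ ⊆ Ω

/-- `Du` is the weak (distributional) gradient of `u` in the open set `Ω`. -/
structure IsWeakGradient {n : ℕ} (Ω : Set (ExtSpace n)) (u : ExtSpace n → ℝ)
    (Du : ExtSpace n → ExtSpace n) : Prop where
  locallyIntegrableOn : LocallyIntegrableOn u Ω volume
  locallyIntegrableOn_grad : LocallyIntegrableOn Du Ω volume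
  integral_eq : ∀ ξ : ExtSpace n → ℝ, IsTestFunction Ω ξ → ∀ v : ExtSpace n,
    ∫ p in Ω, u p * fderiv ℝ ξ p v = -∫ p in Ω, dotExt (Du p) v * ξ p

/-- The measure `y^a dx dy` on a subset `Ω` of the half-space `{y > 0}`. -/
noncomputable def weightedMeasure {n : ℕ} (a : ℝ) (Ω : Set (ExtSpace n)) :
    Measure (ExtSpace n) :=
  (volume.restrict Ω).withDensity fun p => ENNReal.ofReal (p.2 ^ a)

/-- `u` belongs to `H¹(Ω, y^a)` and `Du` is its weak gradient: `u ∈ L²(Ω, y^a dx dy)` and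
`|Du| ∈ L²(Ω, y^a dx dy)`. (The norm of `ℝⁿ × ℝ` used in `MemLp Du` is equivalent to the
Euclidean one.) -/
structure MemWeightedH1 {n : ℕ} (a : ℝ) (Ω : Set (ExtSpace n)) (u : ExtSpace n → ℝ)
    (Du : ExtSpace n → ExtSpace n) : Prop where
  isWeakGradient : IsWeakGradient Ω u Du
  memLp : MemLp u 2 (weightedMeasure a Ω)
  memLp_grad : MemLp Du 2 (weightedMeasure a Ω)

/-- `L_a u = div (y^a ∇u) ≤ 0` in `Ω` in the weak sense, for a function with weak gradient `Du`:
`∫_Ω y^a ∇u · ∇ξ ≥ 0` for all nonnegative test functions `ξ`.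
Here `fderiv ℝ ξ p (Du p)` is `∇ξ(p) · Du(p)`. -/
def IsWeakSupersolution {n : ℕ} (a : ℝ) (Ω : Set (ExtSpace n))
    (Du : ExtSpace n → ExtSpace n) : Prop :=
  ∀ ξ : ExtSpace n → ℝ, IsTestFunction Ω ξ → (∀ p, 0 ≤ ξ p) →
    0 ≤ ∫ p in Ω, p.2 ^ a * fderiv ℝ ξ p (Du p)

/-- The conormal derivative `∂_{ν^a} u (x, 0) = -lim_{y → 0⁺} y^a u_y(x, y)` exists and equals
`ℓ`, where `u_y(x, y)` is a classical derivative for all small `y > 0`. -/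
def HasConormalDerivAt {n : ℕ} (a : ℝ) (u : ExtSpace n → ℝ) (x : EuclideanSpace ℝ (Fin n))
    (ℓ : ℝ) : Prop :=
  (∀ᶠ y in 𝓝[>] (0 : ℝ), DifferentiableAt ℝ (fun t : ℝ => u (x, t)) y) ∧
    Tendsto (fun y : ℝ => -(y ^ a * deriv (fun t : ℝ => u (x, t)) y)) (𝓝[>] 0) (𝓝 ℓ)

/-! This is Hopf's lemma, proved with a barrier. The function `y^(1-a)` is annihilated by `L_a`, and
`w = ε y^(1-a) (1 - k|x|² + A y)` satisfies `L_a w = ε (A(2-a) - 2nk y)`, which is positive for `y ≤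
1` when `A` is large. In a thin box around the origin the constants can be chosen so that `w ≤ u` on
the whole boundary. Comparison then gives `w ≤ u` inside, hence `u(0,y) ≥ ε y^(1-a)`
(`exists_rpow_le_of_supersolution`), and the limsup is at most `-ε`.

The comparison (`IsWeakSupersolution.not_exists_interior_max`) has to handle a supersolution that is
merely weak and continuous. With `W = y^(a/2) u`, the inequality `L_a u ≤ 0` becomes `ΔW + b y^(-2)
W ≤ 0` in the sense of distributions, `b = a(2-a)/4`. The principal part now has constant
coefficients, so mollification preserves the inequality up to a small error in the zero-order term,
and the classical second-order condition at a maximum applies. The sign of `b` is harmless: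
constants solve `L_a = 0`, so `y^(a/2)` solves the conjugated equation, and a multiple of it is
subtracted to make the maximum value zero.

If `y^a u_y` equals a continuous `g`, mollification also gives `u_y = y^(-a) g` classically
(`hasLineDerivAt_of_weak`). Were `g(0,0) ≤ 0`, integrating from `u(0,0) = 0` would contradict the
lower bound. -/

/-- The necessary second-order condition at a local maximum. -/
theorem second_deriv_nonpos_of_isLocalMax {f f' : ℝ → ℝ} {x l : ℝ}
    (hf : ∀ᶠ t in 𝓝 x, HasDerivAt f (f' t) t) (hf' : HasDerivAt f' l x)
    (hmax : IsLocalMax f x) : l ≤ 0 := by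
  by_contra! hl
  have hd : deriv f =ᶠ[𝓝 x] f' := hf.mono fun t ht => ht.deriv
  have hdd : deriv (deriv f) x = l := by rw [hd.deriv_eq, hf'.deriv]
  -- A positive second derivative makes the maximum a minimum as well, so `f` is locally constant
  -- and `l = 0`.
  have hmin : IsLocalMin f x :=
    isLocalMin_of_deriv_deriv_pos (by rwa [hdd]) hmax.deriv_eq_zero
      hf.self_of_nhds.continuousAt
  have hconst : f =ᶠ[𝓝 x] fun _ => f x := by
    filter_upwards [hmin, hmax] with t h1 h2 using le_antisymm h2 h1
  have h0 : deriv f =ᶠ[𝓝 x] fun _ => 0 := by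
    filter_upwards [eventually_eventually_nhds.2 hconst] with t ht
    rw [EventuallyEq.deriv_eq (f := fun _ => f x) ht, deriv_const]
  have : deriv (deriv f) x = 0 := by rw [h0.deriv_eq, deriv_const]
  linarith

/-! ### Mollification and cutoffs -/

section Mollification

variable {E : Type*} [NormedAddCommGroup E] [NormedSpace ℝ E] [FiniteDimensional ℝ E]
  [MeasurableSpace E] [BorelSpace E] {μ : Measure E} [μ.IsAddHaarMeasure]

theorem hasDerivAt_integral_sub_mul {ρ g : E → ℝ} (hρ : ContDiff ℝ 1 ρ)
    (hρc : HasCompactSupport ρ) (hg : Continuous g) (p e : E) (t : ℝ) :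
    HasDerivAt (fun s : ℝ => ∫ q, ρ (p + s • e - q) * g q ∂μ)
      (∫ q, fderiv ℝ ρ (p + t • e - q) e * g q ∂μ) t := by
  have h := hρc.hasFDerivAt_convolution_left (ContinuousLinearMap.mul ℝ ℝ)
    (μ := μ) hρ hg.locallyIntegrable (p + t • e)
  have hl : HasDerivAt (fun s : ℝ => p + s • e) e t := by
    simpa using ((hasDerivAt_id t).smul_const e).const_add p
  have h2 := h.comp_hasDerivAt t hl
  have e1 : ∀ x, (MeasureTheory.convolution ρ g (ContinuousLinearMap.mul ℝ ℝ) μ) x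
      = ∫ q, ρ (x - q) * g q ∂μ := fun x => convolution_mul_swap
  refine (h2.congr_deriv ?_).congr_of_eventuallyEq (Eventually.of_forall fun s => (e1 _).symm)
  rw [convolution_eq_swap, ContinuousLinearMap.integral_apply]
  · rfl
  · have hc : Continuous (fderiv ℝ ρ) := hρ.continuous_fderiv (by norm_num)
    have hcs := hρc.fderiv (𝕜 := ℝ)
    have := (hcs.convolutionExists_left ((ContinuousLinearMap.mul ℝ ℝ).precompL E) hc
      (μ := μ) hg.locallyIntegrable (p + t • e)).integrable_swap
    exact this

/-- Mollification of a uniformly continuous function converges uniformly. -/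
theorem exists_mollification_close {g : E → ℝ} (hg : Continuous g) (hgc : HasCompactSupport g)
    {κ : ℝ} (hκ : 0 < κ) :
    ∃ d > 0, ∀ φ : ContDiffBump (0 : E), φ.rOut ≤ d →
      ∀ p, |∫ q, φ.normed μ (p - q) * g q ∂μ - g p| ≤ κ := by
  have hu := hgc.uniformContinuous_of_continuous hg
  obtain ⟨d, hd, H⟩ := Metric.uniformContinuous_iff.1 hu κ hκ
  refine ⟨d, hd, fun φ hφ p => ?_⟩
  have := φ.dist_normed_convolution_le (μ := μ) (x₀ := p) (ε := κ) hg.aestronglyMeasurable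
    (fun x hx => (H ((Metric.mem_ball.1 hx).trans_le hφ)).le)
  rwa [convolution_lsmul_swap, Real.dist_eq] at this

end Mollification

theorem ContinuousOn.continuous_mul_of_tsupport_subset {X : Type*} [TopologicalSpace X]
    {U : Set X} (hU : IsOpen U) {f χ : X → ℝ} (hf : ContinuousOn f U) (hχ : Continuous χ)
    (hs : tsupport χ ⊆ U) : Continuous fun x => χ x * f x := by
  refine continuous_of_tsupport fun x hx => ?_
  have hx' : x ∈ U := hs (closure_mono (Function.support_mul_subset_left _ _) hx)
  exact hχ.continuousAt.mul (hf.continuousAt (hU.mem_nhds hx'))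

/-- The margin `d` is what matters: a mollifier of radius at most `d` centred on `K` does not see
the cutoff. -/
theorem exists_cutoff {X : Type*} [MetricSpace X] [ProperSpace X] {K U : Set X}
    (hK : IsCompact K) (hU : IsOpen U) (hKU : K ⊆ U) :
    ∃ d > 0, ∃ χ : X → ℝ, Continuous χ ∧ HasCompactSupport χ ∧ tsupport χ ⊆ U ∧
      ∀ p ∈ K, ∀ q, dist q p ≤ d → q ∈ U ∧ χ q = 1 := by
  obtain ⟨d, hd, hdU⟩ := hK.exists_cthickening_subset_open hU hKU
  obtain ⟨f, h1, h2, h3, -⟩ := exists_continuousMap_one_of_isCompact_subset_isOpen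
    (hK.cthickening (r := d)) hU hdU
  refine ⟨d, hd, f, f.continuous, h2, h3, fun p hp q hq => ?_⟩
  have hm : q ∈ Metric.cthickening d K := Metric.mem_cthickening_of_dist_le q p d K hp hq
  exact ⟨hdU hm, h1 hm⟩

/-! ### Test functions -/

instance isAddHaarMeasure_volume_extSpace (n : ℕ) :
    (volume : Measure (ExtSpace n)).IsAddHaarMeasure :=
  Measure.prod.instIsAddHaarMeasure _ _

theorem isOpen_unitCylinder (n : ℕ) (R : ℝ) : IsOpen (unitCylinder n R) :=
  Metric.isOpen_ball.prod isOpen_Ioo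

namespace IsTestFunction

variable {n : ℕ} {Ω : Set (ExtSpace n)} {ξ : ExtSpace n → ℝ}

theorem fderiv_apply (h : IsTestFunction Ω ξ) (v : ExtSpace n) :
    IsTestFunction Ω fun p => fderiv ℝ ξ p v where
  contDiff := (h.contDiff.fderiv_right (m := ∞) (by simp)).clm_apply contDiff_const
  hasCompactSupport := h.hasCompactSupport.fderiv_apply ℝ v
  tsupport_subset := (tsupport_fderiv_apply_subset ℝ v).trans h.tsupport_subset

theorem contDiffOn_mul (h : IsTestFunction Ω ξ) (hΩ : IsOpen Ω) {c : ExtSpace n → ℝ}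
    (hc : ContDiffOn ℝ ∞ c Ω) : IsTestFunction Ω fun p => c p * ξ p where
  contDiff := by
    refine contDiff_iff_contDiffAt.2 fun p => ?_
    by_cases hp : p ∈ tsupport ξ
    · exact (hc.contDiffAt (hΩ.mem_nhds (h.tsupport_subset hp))).mul h.contDiff.contDiffAt
    · refine (contDiffAt_const (c := (0 : ℝ))).congr_of_eventuallyEq ?_
      filter_upwards [notMem_tsupport_iff_eventuallyEq.1 hp] with q hq
      simp [hq]
  hasCompactSupport := h.hasCompactSupport.mul_left
  tsupport_subset :=
    (closure_mono (Function.support_mul_subset_right _ _)).trans h.tsupport_subset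

theorem integrableOn_mul (h : IsTestFunction Ω ξ) {f : ExtSpace n → ℝ}
    (hf : LocallyIntegrableOn f Ω volume) : IntegrableOn (fun p => f p * ξ p) Ω volume := by
  have hK : IntegrableOn f (tsupport ξ) volume :=
    hf.integrableOn_compact_subset h.tsupport_subset h.hasCompactSupport
  have h1 : IntegrableOn (fun p => f p * ξ p) (tsupport ξ) volume :=
    hK.mul_continuousOn h.contDiff.continuous.continuousOn h.hasCompactSupport
  refine (integrableOn_iff_integrable_of_support_subset ?_).1 h1 |>.integrableOn
  exact (Function.support_mul_subset_right _ _).trans (subset_tsupport _)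

end IsTestFunction

/-! ### Conjugation by `y^(a/2)` -/

/-- The coordinate vectors of `ℝⁿ × ℝ`; `none` is the extension direction. -/
noncomputable def coordDir (n : ℕ) : Option (Fin n) → ExtSpace n
  | none => (0, 1)
  | some i => (EuclideanSpace.single i 1, 0)

/-- The Laplacian of `ℝⁿ × ℝ` as the sum of the pure second derivatives. -/
noncomputable def lapExt {n : ℕ} (ζ : ExtSpace n → ℝ) (p : ExtSpace n) : ℝ :=
  ∑ i, fderiv ℝ (fun q => fderiv ℝ ζ q (coordDir n i)) p (coordDir n i)

theorem sum_dotExt_smul_coordDir {n : ℕ} (v : ExtSpace n) :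
    ∑ i, dotExt v (coordDir n i) • coordDir n i = v := by
  rw [Fintype.sum_option]
  refine Prod.ext ?_ ?_
  · ext j
    simp [dotExt, coordDir, Prod.fst_sum, EuclideanSpace.inner_single_right,
      Pi.single_apply]
  · simp [dotExt, coordDir, Prod.snd_sum]

theorem hasFDerivAt_snd_rpow {n : ℕ} (s : ℝ) {p : ExtSpace n} (hp : 0 < p.2) :
    HasFDerivAt (fun q : ExtSpace n => q.2 ^ s)
      ((s * p.2 ^ (s - 1)) • ContinuousLinearMap.snd ℝ (EuclideanSpace ℝ (Fin n)) ℝ) p :=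
  (Real.hasDerivAt_rpow_const (Or.inl hp.ne')).comp_hasFDerivAt p hasFDerivAt_snd

theorem contDiffOn_snd_rpow {n : ℕ} (s : ℝ) {Ω : Set (ExtSpace n)} (hΩ : ∀ p ∈ Ω, 0 < p.2) :
    ContDiffOn ℝ ∞ (fun q : ExtSpace n => q.2 ^ s) Ω := fun p hp =>
  ((contDiff_snd.contDiffAt).rpow_const_of_ne (hΩ p hp).ne').contDiffWithinAt

theorem fderiv_snd_rpow_mul {n : ℕ} (s : ℝ) {ζ : ExtSpace n → ℝ} {p : ExtSpace n}
    (hp : 0 < p.2) (hζ : DifferentiableAt ℝ ζ p) (v : ExtSpace n) :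
    fderiv ℝ (fun q => q.2 ^ s * ζ q) p v =
      p.2 ^ s * fderiv ℝ ζ p v + s * p.2 ^ (s - 1) * v.2 * ζ p := by
  rw [((hasFDerivAt_snd_rpow s hp).fun_mul hζ.hasFDerivAt).fderiv]
  simp
  ring

/-- Conjugating `div (y^a ∇ ·)` by `y^(a/2)` removes the first-order term. -/
theorem sum_fderiv_rpow_mul_fderiv {n : ℕ} (a : ℝ) {ζ : ExtSpace n → ℝ} (hζ : ContDiff ℝ ∞ ζ)
    {p : ExtSpace n} (hp : 0 < p.2) :
    ∑ i, fderiv ℝ (fun q => q.2 ^ a *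
        fderiv ℝ (fun r : ExtSpace n => r.2 ^ (-(a / 2)) * ζ r) q (coordDir n i)) p
          (coordDir n i) =
      p.2 ^ (a / 2) * (lapExt ζ p + a * (2 - a) / 4 * ((p.2 ^ 2)⁻¹ * ζ p)) := by
  have hpos : ∀ᶠ q : ExtSpace n in 𝓝 p, 0 < q.2 :=
    continuous_snd.continuousAt.eventually (lt_mem_nhds hp)
  have hdiff : Differentiable ℝ ζ := hζ.differentiable (by simp)
  have key : ∀ v : ExtSpace n, fderiv ℝ (fun q => q.2 ^ a *
        fderiv ℝ (fun r : ExtSpace n => r.2 ^ (-(a / 2)) * ζ r) q v) p v =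
      p.2 ^ (a / 2) * (fderiv ℝ (fun q => fderiv ℝ ζ q v) p v +
        v.2 ^ 2 * (a * (2 - a) / 4 * ((p.2 ^ 2)⁻¹ * ζ p))) := by
    intro v
    -- Differentiating this form once more, the two first-order terms `± (a/2) y^(a/2-1) v₂ ∂ᵥζ`
    -- cancel, and `-(a/2)(a/2 - 1) = a(2-a)/4` remains.
    have hE : (fun q => q.2 ^ a *
        fderiv ℝ (fun r : ExtSpace n => r.2 ^ (-(a / 2)) * ζ r) q v) =ᶠ[𝓝 p]
        fun q => q.2 ^ (a / 2) * fderiv ℝ ζ q v +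
          q.2 ^ (a / 2 - 1) * ((-(a / 2) * v.2) * ζ q) := by
      filter_upwards [hpos] with q hq
      rw [fderiv_snd_rpow_mul _ hq (hdiff q), mul_add, ← mul_assoc, ← Real.rpow_add hq,
        show q.2 ^ (a / 2 - 1) = q.2 ^ a * q.2 ^ (-(a / 2) - 1) by
          rw [← Real.rpow_add hq]; ring_nf]
      rw [show a + -(a / 2) = a / 2 by ring]
      ring
    have hd1 : Differentiable ℝ fun q => fderiv ℝ ζ q v :=
      ((hζ.fderiv_right (m := ∞) (by simp)).clm_apply contDiff_const).differentiable (by simp)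
    have hd2 : Differentiable ℝ fun q => (-(a / 2) * v.2) * ζ q := hdiff.const_mul _
    rw [hE.fderiv_eq, fderiv_fun_add, add_apply,
      fderiv_snd_rpow_mul _ hp (hd1 p), fderiv_snd_rpow_mul _ hp (hd2 p),
      fderiv_const_mul (hdiff p)]
    · have e1 : p.2 ^ (a / 2 - 1 - 1) = p.2 ^ (a / 2) * (p.2 ^ 2)⁻¹ := by
        rw [show a / 2 - 1 - 1 = a / 2 + (-2 : ℝ) by ring, Real.rpow_add hp,
          Real.rpow_neg hp.le, Real.rpow_two]
      rw [e1]
      simp only [smul_apply, smul_eq_mul]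
      ring
    · exact (hasFDerivAt_snd_rpow _ hp).differentiableAt.mul (hd1 p)
    · exact (hasFDerivAt_snd_rpow _ hp).differentiableAt.mul (hd2 p)
  simp only [key, ← Finset.mul_sum, Finset.sum_add_distrib]
  congr 1
  unfold lapExt
  congr 1
  rw [Fintype.sum_option]
  simp [coordDir]

/-- Testing against `y^(-a/2) ζ` and moving all derivatives to the test function. -/
theorem IsWeakSupersolution.integral_lapExt_nonpos {n : ℕ} {a : ℝ} {Ω : Set (ExtSpace n)}
    (hΩ : IsOpen Ω) (hΩpos : ∀ p ∈ Ω, 0 < p.2) {u : ExtSpace n → ℝ}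
    {Du : ExtSpace n → ExtSpace n} (hs : IsWeakSupersolution a Ω Du)
    (hw : IsWeakGradient Ω u Du) {ζ : ExtSpace n → ℝ} (hζ : IsTestFunction Ω ζ)
    (hζ0 : ∀ p, 0 ≤ ζ p) :
    ∫ p in Ω, p.2 ^ (a / 2) * u p * (lapExt ζ p + a * (2 - a) / 4 * ((p.2 ^ 2)⁻¹ * ζ p)) ≤ 0 := by
  have hξ : IsTestFunction Ω fun r : ExtSpace n => r.2 ^ (-(a / 2)) * ζ r :=
    hζ.contDiffOn_mul hΩ (contDiffOn_snd_rpow _ hΩpos)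
  set ξ : ExtSpace n → ℝ := fun r => r.2 ^ (-(a / 2)) * ζ r with hξdef
  -- The weight is smooth in `Ω`, so `y^a ∂ᵥξ` may itself be used in the definition of the weak
  -- gradient.
  have hη : ∀ v, IsTestFunction Ω fun q : ExtSpace n => q.2 ^ a * fderiv ℝ ξ q v := fun v =>
    (hξ.fderiv_apply v).contDiffOn_mul hΩ (contDiffOn_snd_rpow _ hΩpos)
  have hξ0 : ∀ p, 0 ≤ ξ p := by
    intro p
    by_cases hp : p ∈ Ω
    · exact mul_nonneg (Real.rpow_nonneg (hΩpos p hp).le _) (hζ0 p)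
    · have : ζ p = 0 := by
        by_contra h
        exact hp (hζ.tsupport_subset (subset_tsupport _ h))
      simp [hξdef, this]
  have h0 := hs ξ hξ hξ0
  have hdot : ∀ v, LocallyIntegrableOn (fun p => dotExt (Du p) v) Ω volume := by
    intro v
    have hL : ∃ L : ExtSpace n →L[ℝ] ℝ, ∀ w, L w = dotExt w v :=
      ⟨((innerSL ℝ v.1).comp (ContinuousLinearMap.fst ℝ _ _)) +
        v.2 • ContinuousLinearMap.snd ℝ _ _, fun w => by
          simp [dotExt, real_inner_comm, mul_comm]⟩
    obtain ⟨L, hL⟩ := hL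
    simp only [← hL]
    intro p hp
    obtain ⟨s, hs, hi⟩ := hw.locallyIntegrableOn_grad p hp
    exact ⟨s, hs, L.integrable_comp hi⟩
  have e1 : ∫ p in Ω, p.2 ^ a * fderiv ℝ ξ p (Du p) =
      ∑ i, ∫ p in Ω, dotExt (Du p) (coordDir n i) *
        (p.2 ^ a * fderiv ℝ ξ p (coordDir n i)) := by
    rw [← integral_finsetSum _ fun i _ => (hη _).integrableOn_mul (hdot _)]
    refine integral_congr_ae (Eventually.of_forall fun p => ?_)
    dsimp only
    conv_lhs => rw [← sum_dotExt_smul_coordDir (Du p)]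
    rw [map_sum, Finset.mul_sum]
    refine Finset.sum_congr rfl fun i _ => ?_
    rw [map_smul, smul_eq_mul]
    ring
  have e2 : ∀ i, ∫ p in Ω, dotExt (Du p) (coordDir n i) *
        (p.2 ^ a * fderiv ℝ ξ p (coordDir n i)) =
      -∫ p in Ω, u p * fderiv ℝ (fun q : ExtSpace n => q.2 ^ a * fderiv ℝ ξ q (coordDir n i)) p
        (coordDir n i) := fun i => by
    rw [hw.integral_eq _ (hη (coordDir n i)), neg_neg]
  rw [e1, Finset.sum_congr rfl fun i _ => e2 i, Finset.sum_neg_distrib,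
    ← integral_finsetSum _ fun i _ =>
      ((hη _).fderiv_apply _).integrableOn_mul hw.locallyIntegrableOn] at h0
  have e3 : ∫ p in Ω, p.2 ^ (a / 2) * u p *
        (lapExt ζ p + a * (2 - a) / 4 * ((p.2 ^ 2)⁻¹ * ζ p)) =
      ∫ p in Ω, ∑ i, u p * fderiv ℝ (fun q : ExtSpace n =>
        q.2 ^ a * fderiv ℝ ξ q (coordDir n i)) p (coordDir n i) := by
    refine setIntegral_congr_fun hΩ.measurableSet fun p hp => ?_
    rw [← Finset.mul_sum, sum_fderiv_rpow_mul_fderiv a hζ.contDiff (hΩpos p hp)]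
    ring
  rw [e3]
  linarith

/-! ### Line derivatives and reflected mollifiers -/

/-- Restrict to the line through `p`. Line derivatives suffice because the comparison uses only pure
second derivatives along coordinate directions. -/
theorem second_lineDeriv_nonpos_of_isLocalMax {E : Type*} [NormedAddCommGroup E]
    [NormedSpace ℝ E] {F F' : E → ℝ} {l : ℝ} {p e : E}
    (hF : ∀ᶠ q in 𝓝 p, HasLineDerivAt ℝ F (F' q) q e) (hF' : HasLineDerivAt ℝ F' l p e)
    (hmax : IsLocalMax F p) : l ≤ 0 := by
  have hc : Tendsto (fun t : ℝ => p + t • e) (𝓝 0) (𝓝 p) := by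
    have : Continuous fun t : ℝ => p + t • e := by fun_prop
    simpa using this.tendsto 0
  refine second_deriv_nonpos_of_isLocalMax (f := fun t => F (p + t • e))
    (f' := fun t => F' (p + t • e)) (x := 0) ?_ hF' ?_
  · filter_upwards [hc.eventually hF] with t ht
    have ht' : HasDerivAt (fun s : ℝ => F (p + t • e + s • e)) (F' (p + t • e)) (t - t) := by
      rw [sub_self]
      exact ht
    refine (ht'.comp_sub_const t t).congr_of_eventuallyEq (Eventually.of_forall fun s => ?_)
    simp only [add_assoc, ← add_smul]
    congr 3
    ring
  · filter_upwards [hc.eventually hmax] with t ht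
    simpa using ht

theorem hasLineDerivAt_integral_sub_mul {E : Type*} [NormedAddCommGroup E] [NormedSpace ℝ E]
    [FiniteDimensional ℝ E] [MeasurableSpace E] [BorelSpace E] {μ : Measure E}
    [μ.IsAddHaarMeasure] {ρ g : E → ℝ} (hρ : ContDiff ℝ 1 ρ) (hρc : HasCompactSupport ρ)
    (hg : Continuous g) (p e : E) :
    HasLineDerivAt ℝ (fun x => ∫ q, ρ (x - q) * g q ∂μ)
      (∫ q, fderiv ℝ ρ (p - q) e * g q ∂μ) p e := by
  unfold HasLineDerivAt
  simpa using hasDerivAt_integral_sub_mul (μ := μ) hρ hρc hg p e 0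

theorem continuous_integral_sub_mul {E : Type*} [NormedAddCommGroup E] [NormedSpace ℝ E]
    [FiniteDimensional ℝ E] [MeasurableSpace E] [BorelSpace E] {μ : Measure E}
    [μ.IsAddHaarMeasure] {ρ g : E → ℝ} (hρ : Continuous ρ) (hρc : HasCompactSupport ρ)
    (hg : Continuous g) : Continuous fun x => ∫ q, ρ (x - q) * g q ∂μ := by
  have h := hρc.continuous_convolution_left (ContinuousLinearMap.mul ℝ ℝ) (μ := μ) hρ
    hg.locallyIntegrable
  convert h using 1
  ext x
  exact convolution_mul_swap.symm

theorem hasLineDerivAt_snd_rpow {n : ℕ} (s : ℝ) {p : ExtSpace n} (hp : 0 < p.2)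
    (v : ExtSpace n) :
    HasLineDerivAt ℝ (fun q : ExtSpace n => q.2 ^ s) (s * p.2 ^ (s - 1) * v.2) p v := by
  simpa using (hasFDerivAt_snd_rpow s hp).hasLineDerivAt v

section Reflected

variable {n : ℕ} {ρ : ExtSpace n → ℝ}

theorem fderiv_const_sub_apply (hρ : Differentiable ℝ ρ) {p q v : ExtSpace n} :
    fderiv ℝ (fun q => ρ (p - q)) q v = -fderiv ℝ ρ (p - q) v := by
  have h := (hρ (p - q)).hasFDerivAt.comp q ((hasFDerivAt_id q).const_sub p)
  rw [show (fun q => ρ (p - q)) = ρ ∘ HSub.hSub p from rfl, h.fderiv]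
  simp

theorem lapExt_const_sub (hρ : ContDiff ℝ ∞ ρ) {p q : ExtSpace n} :
    lapExt (fun q => ρ (p - q)) q = lapExt ρ (p - q) := by
  unfold lapExt
  refine Finset.sum_congr rfl fun i _ => ?_
  have : (fun r => fderiv ℝ (fun q => ρ (p - q)) r (coordDir n i)) =
      fun r => (fun s => -fderiv ℝ ρ s (coordDir n i)) (p - r) :=
    funext fun r => fderiv_const_sub_apply (hρ.differentiable (by simp))
  have hd : Differentiable ℝ fun s => fderiv ℝ ρ s (coordDir n i) :=
    ((hρ.fderiv_right (m := ∞) (by simp)).clm_apply contDiff_const).differentiable (by simp)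
  rw [this, fderiv_const_sub_apply hd.fun_neg, fderiv_fun_neg]
  simp

theorem isTestFunction_normed_const_sub {Ω : Set (ExtSpace n)}
    (φ : ContDiffBump (0 : ExtSpace n)) {p : ExtSpace n}
    (hp : Metric.closedBall p φ.rOut ⊆ Ω) :
    IsTestFunction Ω fun q => φ.normed volume (p - q) := by
  have hs : tsupport (fun q => φ.normed volume (p - q)) ⊆ Metric.closedBall p φ.rOut := by
    refine closure_minimal (fun q hq => ?_) Metric.isClosed_closedBall
    have : p - q ∈ Function.support (φ.normed volume) := hq
    rw [φ.support_normed_eq, mem_ball_zero_iff] at this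
    rw [Metric.mem_closedBall, dist_comm, dist_eq_norm]
    exact this.le
  exact ⟨φ.contDiff_normed.comp (contDiff_const.sub contDiff_id),
    HasCompactSupport.of_support_subset_isCompact (isCompact_closedBall p φ.rOut)
      ((subset_tsupport _).trans hs), hs.trans hp⟩

theorem normed_eventuallyEq_zero (φ : ContDiffBump (0 : ExtSpace n)) {p q : ExtSpace n}
    (hq : q ∉ Metric.closedBall p φ.rOut) : φ.normed volume =ᶠ[𝓝 (p - q)] 0 := by
  refine notMem_tsupport_iff_eventuallyEq.1 ?_
  rw [φ.tsupport_normed_eq, mem_closedBall_zero_iff, ← dist_eq_norm, dist_comm]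
  exact hq

end Reflected

/-! ### Comparison principle -/

/-- The weak inequality, tested against a mollifier centred at `p`. -/
theorem IsWeakSupersolution.mollified_le {n : ℕ} {a : ℝ} {Ω : Set (ExtSpace n)}
    (hΩ : IsOpen Ω) (hΩpos : ∀ p ∈ Ω, 0 < p.2) {u : ExtSpace n → ℝ}
    {Du : ExtSpace n → ExtSpace n} (hs : IsWeakSupersolution a Ω Du)
    (hw : IsWeakGradient Ω u Du) (φ : ContDiffBump (0 : ExtSpace n)) {p : ExtSpace n}
    (hp : Metric.closedBall p φ.rOut ⊆ Ω) {χ : ExtSpace n → ℝ}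
    (hχ : ∀ q ∈ Metric.closedBall p φ.rOut, χ q = 1)
    (hW : Continuous fun q => χ q * (q.2 ^ (a / 2) * u q))
    (hV : Continuous fun q => χ q * ((q.2 ^ 2)⁻¹ * (q.2 ^ (a / 2) * u q))) :
    (∑ i, ∫ q, fderiv ℝ (fun s => fderiv ℝ (φ.normed volume) s (coordDir n i)) (p - q)
        (coordDir n i) * (χ q * (q.2 ^ (a / 2) * u q))) +
      a * (2 - a) / 4 *
        ∫ q, φ.normed volume (p - q) * (χ q * ((q.2 ^ 2)⁻¹ * (q.2 ^ (a / 2) * u q))) ≤ 0 := by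
  set ρ : ExtSpace n → ℝ := φ.normed volume with hρ
  have hρs : ContDiff ℝ ∞ ρ := φ.contDiff_normed
  have hρc : HasCompactSupport ρ := φ.hasCompactSupport_normed
  have ht : IsTestFunction univ ρ := ⟨hρs, hρc, subset_univ _⟩
  have h := hs.integral_lapExt_nonpos hΩ hΩpos hw (isTestFunction_normed_const_sub φ hp)
    (fun q => φ.nonneg_normed _)
  simp only [← hρ] at h
  have hint : ∀ {f g : ExtSpace n → ℝ}, Continuous f → HasCompactSupport f → Continuous g →
      Integrable fun q => f (p - q) * g q := by
    intro f g hf hfc hg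
    refine Continuous.integrable_of_hasCompactSupport (by fun_prop) ?_
    exact (hfc.comp_homeomorph (Homeomorph.subLeft p)).mul_right
  -- Off the ball the kernel vanishes, and on it `χ = 1`; so both the cutoff and the restriction to
  -- `Ω` can be dropped.
  have hzero : ∀ q ∉ Metric.closedBall p φ.rOut, ρ (p - q) = 0 ∧ lapExt ρ (p - q) = 0 := by
    intro q hq
    have h0 := normed_eventuallyEq_zero φ hq
    refine ⟨h0.self_of_nhds, Finset.sum_eq_zero fun i _ => ?_⟩
    have : (fun s => fderiv ℝ ρ s (coordDir n i)) =ᶠ[𝓝 (p - q)] fun _ => 0 := by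
      filter_upwards [eventually_eventually_nhds.2 h0] with s hs
      rw [EventuallyEq.fderiv_eq (f := 0) hs]
      simp
    rw [this.fderiv_eq]
    simp
  rw [← integral_finsetSum, ← integral_const_mul, ← integral_add]
  · rw [setIntegral_eq_integral_of_forall_compl_eq_zero] at h
    · refine le_of_eq_of_le (integral_congr_ae (Eventually.of_forall fun q => ?_)) h
      dsimp only
      rw [lapExt_const_sub hρs, ← Finset.sum_mul]
      change lapExt ρ (p - q) * _ + _ = _
      by_cases hq : q ∈ Metric.closedBall p φ.rOut
      · rw [hχ q hq]
        ring
      · rw [(hzero q hq).1, (hzero q hq).2]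
        ring
    · intro q hq
      have hq' : q ∉ Metric.closedBall p φ.rOut := fun h => hq (hp h)
      rw [lapExt_const_sub hρs, (hzero q hq').1, (hzero q hq').2]
      ring
  · refine integrable_finsetSum _ fun i _ => ?_
    have hi := (ht.fderiv_apply (coordDir n i)).fderiv_apply (coordDir n i)
    exact hint hi.contDiff.continuous hi.hasCompactSupport hW
  · exact (hint hρs.continuous hρc hV).const_mul _
  · intro i _
    have hi := (ht.fderiv_apply (coordDir n i)).fderiv_apply (coordDir n i)
    exact hint hi.contDiff.continuous hi.hasCompactSupport hW

theorem HasLineDerivAt.sub_real {E : Type*} [AddCommGroup E] [Module ℝ E] {f g : E → ℝ}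
    {f' g' : ℝ} {p e : E} (hf : HasLineDerivAt ℝ f f' p e) (hg : HasLineDerivAt ℝ g g' p e) :
    HasLineDerivAt ℝ (fun q => f q - g q) (f' - g') p e :=
  HasDerivAt.sub hf hg

theorem HasLineDerivAt.const_mul_real {E : Type*} [AddCommGroup E] [Module ℝ E] {f : E → ℝ}
    {f' : ℝ} {p e : E} (c : ℝ) (hf : HasLineDerivAt ℝ f f' p e) :
    HasLineDerivAt ℝ (fun q => c * f q) (c * f') p e :=
  HasDerivAt.const_mul c hf

theorem hasLineDerivAt_snd_rpow_two {n : ℕ} (s : ℝ) {p : ExtSpace n} (hp : 0 < p.2)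
    (v : ExtSpace n) :
    HasLineDerivAt ℝ (fun q : ExtSpace n => s * q.2 ^ (s - 1) * v.2)
      (s * (s - 1) * p.2 ^ (s - 1 - 1) * v.2 ^ 2) p v := by
  have h := HasLineDerivAt.const_mul_real (s * v.2) (hasLineDerivAt_snd_rpow (s - 1) hp v)
  convert h using 1
  · ext q
    ring
  · ring

/-- A strict smooth subsolution cannot touch a weak supersolution from below: the difference
`w - u` has no interior maximum. The barrier is given through `B = y^(a/2) w`. -/
theorem IsWeakSupersolution.not_exists_interior_max {n : ℕ} {a : ℝ} {Ω U K : Set (ExtSpace n)}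
    (hΩ : IsOpen Ω) (hΩpos : ∀ p ∈ Ω, 0 < p.2) {u : ExtSpace n → ℝ}
    {Du : ExtSpace n → ExtSpace n} (hs : IsWeakSupersolution a Ω Du)
    (hw : IsWeakGradient Ω u Du) (hu : ContinuousOn u Ω)
    (hU : IsOpen U) (hUΩ : U ⊆ Ω) (hK : IsCompact K) (hKU : K ⊆ U)
    {w : ExtSpace n → ℝ} (hwc : ContinuousOn w U)
    {B₁ B₂ : Option (Fin n) → ExtSpace n → ℝ}
    (hB₁ : ∀ i, ∀ p ∈ U,
      HasLineDerivAt ℝ (fun q => q.2 ^ (a / 2) * w q) (B₁ i p) p (coordDir n i))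
    (hB₂ : ∀ i, ∀ p ∈ U, HasLineDerivAt ℝ (B₁ i) (B₂ i p) p (coordDir n i))
    {c : ℝ} (hc : 0 < c)
    (hB : ∀ p ∈ K, c ≤ ∑ i, B₂ i p + a * (2 - a) / 4 * ((p.2 ^ 2)⁻¹ * (p.2 ^ (a / 2) * w p)))
    {p₀ : ExtSpace n} (hp₀ : p₀ ∈ K) {m : ℝ} (hm : m < w p₀ - u p₀)
    (hout : ∀ p ∈ U, p ∉ K → w p - u p ≤ m) : False := by
  obtain ⟨d, hd, χ, hχc, hχs, hχU, hχ1⟩ := exists_cutoff hK hU hKU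
  have hUpos : ∀ p ∈ U, 0 < p.2 := fun p hp => hΩpos p (hUΩ hp)
  have hpow : ∀ s : ℝ, ContinuousOn (fun q : ExtSpace n => q.2 ^ s) U := fun s =>
    (contDiffOn_snd_rpow s hUpos).continuousOn
  have hinv : ContinuousOn (fun q : ExtSpace n => (q.2 ^ 2)⁻¹) U :=
    ContinuousOn.inv₀ (by fun_prop) fun q hq => pow_ne_zero 2 (hUpos q hq).ne'
  have huU := hu.mono hUΩ
  set W : ExtSpace n → ℝ := fun q => χ q * (q.2 ^ (a / 2) * u q) with hWdef
  set V : ExtSpace n → ℝ := fun q => χ q * ((q.2 ^ 2)⁻¹ * (q.2 ^ (a / 2) * u q)) with hVdef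
  have hW : Continuous W :=
    ((hpow _).mul huU).continuous_mul_of_tsupport_subset hU hχc hχU
  have hV : Continuous V :=
    (hinv.mul ((hpow _).mul huU)).continuous_mul_of_tsupport_subset hU hχc hχU
  have hWs : HasCompactSupport W := hχs.mul_right
  have hVs : HasCompactSupport V := hχs.mul_right
  -- Half of the margin `d` makes `K` interior to `L`, so a maximum over `L` attained in `K` is
  -- local; the other half is left for the mollifier.
  set L := Metric.cthickening (d / 2) K with hL
  have hLc : IsCompact L := hK.cthickening
  have hnear : ∀ q ∈ L, ∀ r, dist r q ≤ d / 2 → r ∈ U ∧ χ r = 1 := by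
    intro q hq r hr
    rw [hL, hK.cthickening_eq_biUnion_closedBall (by positivity)] at hq
    obtain ⟨p, hp, hqp⟩ := mem_iUnion₂.1 hq
    refine hχ1 p hp r ((dist_triangle r q p).trans ?_)
    rw [Metric.mem_closedBall] at hqp
    linarith
  have hLU : L ⊆ U := fun q hq => (hnear q hq q (by simp; positivity)).1
  have hLχ : ∀ q ∈ L, χ q = 1 := fun q hq => (hnear q hq q (by simp; positivity)).2
  have hKL : K ⊆ L := Metric.self_subset_cthickening K
  obtain ⟨C₁, hC₁⟩ := (hLc.image_of_continuousOn ((hpow (-(a / 2))).mono hLU)).bddAbove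
  obtain ⟨C₂, hC₂⟩ := (hLc.image_of_continuousOn (hinv.mono hLU)).bddAbove
  set C : ℝ := max 1 (max C₁ C₂) with hC
  have hCpos : 0 < C := lt_of_lt_of_le one_pos (le_max_left _ _)
  have hCa : ∀ q ∈ L, q.2 ^ (-(a / 2)) ≤ C := fun q hq =>
    (hC₁ (mem_image_of_mem _ hq)).trans ((le_max_left _ _).trans (le_max_right _ _))
  have hCb : ∀ q ∈ L, (q.2 ^ 2)⁻¹ ≤ C := fun q hq =>
    (hC₂ (mem_image_of_mem _ hq)).trans ((le_max_right _ _).trans (le_max_right _ _))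
  set b : ℝ := a * (2 - a) / 4 with hb
  set gap := w p₀ - u p₀ - m with hgap
  have hgap0 : 0 < gap := by simp only [hgap]; linarith
  -- The first bound keeps the maximum inside `K` after mollification; the second makes the
  -- zero-order error at most `c / 2`.
  set κ : ℝ := min (gap / (3 * C)) (c / (2 * ((|b| + 1) * (C + 1)))) with hκ
  have hden : 0 < (|b| + 1) * (C + 1) := by positivity
  have hκ0 : 0 < κ := lt_min (by positivity) (by positivity)
  have hκ1 : C * κ ≤ gap / 3 := by
    have : κ ≤ gap / (3 * C) := min_le_left _ _
    rw [le_div_iff₀ (by positivity)] at this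
    linarith
  have hκ2 : (|b| + 1) * (C + 1) * κ ≤ c / 2 := by
    have : κ ≤ c / (2 * ((|b| + 1) * (C + 1))) := min_le_right _ _
    rw [le_div_iff₀ (by positivity)] at this
    linarith
  obtain ⟨d₁, hd₁, H₁⟩ := exists_mollification_close (μ := volume) hW hWs hκ0
  obtain ⟨d₂, hd₂, H₂⟩ := exists_mollification_close (μ := volume) hV hVs hκ0
  set r := min (d / 2) (min d₁ d₂) with hr
  have hr0 : 0 < r := lt_min (by positivity) (lt_min hd₁ hd₂)
  let φ : ContDiffBump (0 : ExtSpace n) := ⟨r / 2, r, by positivity, by linarith⟩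
  have HW := H₁ φ ((min_le_right _ _).trans (min_le_left _ _))
  have HV := H₂ φ ((min_le_right _ _).trans (min_le_right _ _))
  set ρ : ExtSpace n → ℝ := φ.normed volume with hρ
  have ht : IsTestFunction univ ρ :=
    ⟨φ.contDiff_normed, φ.hasCompactSupport_normed, subset_univ _⟩
  set Wm : ExtSpace n → ℝ := fun p => ∫ q, ρ (p - q) * W q with hWm
  have hWmc : Continuous Wm :=
    continuous_integral_sub_mul ht.contDiff.continuous ht.hasCompactSupport hW
  -- A twice differentiable stand-in for `w - u`, uniformly close to it on `L`.
  set z : ExtSpace n → ℝ := fun q => q.2 ^ (-(a / 2)) * (q.2 ^ (a / 2) * w q - Wm q) with hz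
  have hcancel : ∀ q ∈ U, q.2 ^ (-(a / 2)) * q.2 ^ (a / 2) = 1 := fun q hq => by
    rw [← Real.rpow_add (hUpos q hq)]
    simp
  have hzc : ContinuousOn z L :=
    (((hpow _).mul (((hpow _).mul hwc).sub hWmc.continuousOn)).mono hLU)
  have hzclose : ∀ q ∈ L, |z q - (w q - u q)| ≤ C * κ := by
    intro q hq
    have e : z q - (w q - u q) = -(q.2 ^ (-(a / 2)) * (Wm q - W q)) := by
      simp only [hz, hWdef, hLχ q hq]
      linear_combination (w q - u q) * hcancel q (hLU hq)
    rw [e, abs_neg, abs_mul, abs_of_nonneg (Real.rpow_nonneg (hUpos q (hLU hq)).le _)]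
    exact mul_le_mul (hCa q hq) (HW q) (abs_nonneg _) hCpos.le
  obtain ⟨p, hpL, hpmax⟩ := hLc.exists_isMaxOn ⟨p₀, hKL hp₀⟩ hzc
  -- Off `K`, `z ≤ m + gap/3`, whereas `z p₀ ≥ m + 2 gap/3`.
  have hpK : p ∈ K := by
    by_contra hpK
    have h1 := hout p (hLU hpL) hpK
    have h2 := abs_le.1 (hzclose p hpL)
    have h3 := abs_le.1 (hzclose p₀ (hKL hp₀))
    have h4 : z p₀ ≤ z p := hpmax (hKL hp₀)
    have h5 : gap = w p₀ - u p₀ - m := hgap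
    linarith [h2.2, h3.1]
  have hpU := hKU hpK
  have hp2 := hUpos p hpU
  have hLn : L ∈ 𝓝 p :=
    Filter.mem_of_superset (Metric.ball_mem_nhds p (half_pos hd)) fun q hq =>
      Metric.mem_cthickening_of_dist_le q p _ K hpK (Metric.mem_ball.1 hq).le
  -- On `L` this is `y^(a/2) (z - z p)`, so it has maximum value zero at `p`. The subtracted
  -- multiple of `y^(a/2)` solves the conjugated equation.
  set F : ExtSpace n → ℝ := fun q => q.2 ^ (a / 2) * w q - Wm q - z p * q.2 ^ (a / 2) with hF
  have hFmax : IsLocalMax F p := by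
    have hFz : ∀ q ∈ L, F q = q.2 ^ (a / 2) * (z q - z p) := fun q hq => by
      simp only [hF, hz]
      linear_combination -(q.2 ^ (a / 2) * w q - Wm q) * hcancel q (hLU hq)
    filter_upwards [hLn] with q hq
    rw [hFz q hq, hFz p hpL, sub_self, mul_zero]
    exact mul_nonpos_of_nonneg_of_nonpos (Real.rpow_nonneg (hUpos q (hLU hq)).le _)
      (sub_nonpos.2 (hpmax hq))
  have hsecond : ∀ i, B₂ i p -
      (∫ q, fderiv ℝ (fun s => fderiv ℝ ρ s (coordDir n i)) (p - q) (coordDir n i) * W q) -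
      z p * (a / 2 * (a / 2 - 1) * p.2 ^ (a / 2 - 1 - 1) * (coordDir n i).2 ^ 2) ≤ 0 := by
    intro i
    have hi := ht.fderiv_apply (coordDir n i)
    refine second_lineDeriv_nonpos_of_isLocalMax (F := F) (p := p) (e := coordDir n i)
      (F' := fun q => B₁ i q - (∫ r, fderiv ℝ ρ (q - r) (coordDir n i) * W r) -
        z p * (a / 2 * q.2 ^ (a / 2 - 1) * (coordDir n i).2)) ?_ ?_ hFmax
    · filter_upwards [hU.mem_nhds hpU] with q hq
      exact ((hB₁ i q hq).sub_real (hasLineDerivAt_integral_sub_mul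
        (ht.contDiff.of_le (by simp)) ht.hasCompactSupport hW q _)).sub_real
          ((hasLineDerivAt_snd_rpow _ (hUpos q hq) _).const_mul_real _)
    · exact ((hB₂ i p hpU).sub_real (hasLineDerivAt_integral_sub_mul
        (hi.contDiff.of_le (by simp)) hi.hasCompactSupport hW p _)).sub_real
          ((hasLineDerivAt_snd_rpow_two _ hp2 _).const_mul_real _)
  have hsum := Finset.sum_nonpos fun i (_ : i ∈ Finset.univ) => hsecond i
  rw [Finset.sum_sub_distrib, Finset.sum_sub_distrib, ← Finset.mul_sum, ← Finset.mul_sum] at hsum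
  have hdir : ∑ i, (coordDir n i).2 ^ 2 = 1 := by
    rw [Fintype.sum_option]
    simp [coordDir]
  rw [hdir, mul_one] at hsum
  have hball : ∀ q ∈ Metric.closedBall p φ.rOut, q ∈ U ∧ χ q = 1 := fun q hq =>
    hnear p hpL q ((Metric.mem_closedBall.1 hq).trans (min_le_left _ _))
  have hmol : (∑ i, ∫ q, fderiv ℝ (fun s => fderiv ℝ ρ s (coordDir n i)) (p - q)
      (coordDir n i) * W q) + b * ∫ q, ρ (p - q) * V q ≤ 0 := hs.mollified_le hΩ hΩpos hw φ (p := p) (fun q hq => hUΩ (hball q hq).1)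
    (fun q hq => (hball q hq).2) hW hV
  have e1 : p.2 ^ (a / 2 - 1 - 1) = p.2 ^ (a / 2) * (p.2 ^ 2)⁻¹ := by
    rw [show a / 2 - 1 - 1 = a / 2 + (-2 : ℝ) by ring, Real.rpow_add hp2,
      Real.rpow_neg hp2.le, Real.rpow_two]
  have e2 : z p * p.2 ^ (a / 2) = p.2 ^ (a / 2) * w p - Wm p := by
    simp only [hz]
    linear_combination (p.2 ^ (a / 2) * w p - Wm p) * hcancel p hpU
  have hVW : V p = (p.2 ^ 2)⁻¹ * W p := by
    simp only [hVdef, hWdef]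
    ring
  -- The commutator of mollification with multiplication by `y^(-2)`: both terms are close to `V p =
  -- y^(-2) W p`.
  have herr : |(p.2 ^ 2)⁻¹ * Wm p - ∫ q, ρ (p - q) * V q| ≤ (C + 1) * κ := by
    have h1 : |(p.2 ^ 2)⁻¹ * (Wm p - W p)| ≤ C * κ := by
      rw [abs_mul, abs_of_nonneg (by positivity)]
      exact mul_le_mul (hCb p hpL) (HW p) (abs_nonneg _) hCpos.le
    have h2 := HV p
    rw [hVW] at h2
    calc _ = |(p.2 ^ 2)⁻¹ * (Wm p - W p) -
          ((∫ q, ρ (p - q) * V q) - (p.2 ^ 2)⁻¹ * W p)| := by ring_nf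
      _ ≤ _ := (abs_sub _ _).trans (by linarith)
  have hberr : b * ((p.2 ^ 2)⁻¹ * Wm p - ∫ q, ρ (p - q) * V q) ≤ c / 2 := by
    refine (le_abs_self _).trans ?_
    rw [abs_mul]
    refine (mul_le_mul (le_add_of_nonneg_right zero_le_one) herr (abs_nonneg _)
      (by positivity)).trans ?_
    linarith
  have hBp := hB p hpK
  have e3 : z p * (a / 2 * (a / 2 - 1) * p.2 ^ (a / 2 - 1 - 1)) =
      -b * ((p.2 ^ 2)⁻¹ * (p.2 ^ (a / 2) * w p - Wm p)) := by
    rw [e1, hb]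
    linear_combination (a / 2 * (a / 2 - 1) * (p.2 ^ 2)⁻¹) * e2
  rw [e3] at hsum
  linarith

/-! ### The barrier and the lower bound -/

/-- Used with `s = 1 - a/2`, where the function is `y^(a/2)` times the barrier, up to the factor
`ε`. -/
theorem hasLineDerivAt_barrier {n : ℕ} (s k A : ℝ) {p : ExtSpace n} (hp : 0 < p.2)
    (v : ExtSpace n) :
    HasLineDerivAt ℝ (fun q : ExtSpace n => q.2 ^ s * (1 - k * ‖q.1‖ ^ 2 + A * q.2))
      (s * p.2 ^ (s - 1) * v.2 * (1 - k * ‖p.1‖ ^ 2 + A * p.2) +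
        p.2 ^ s * (-(2 * k * inner ℝ p.1 v.1) + A * v.2)) p v := by
  have h1 : HasFDerivAt (fun q : ExtSpace n => ‖q.1‖ ^ 2) _ p :=
    (hasStrictFDerivAt_norm_sq p.1).hasFDerivAt.comp p hasFDerivAt_fst
  have h2 := (hasFDerivAt_snd_rpow s hp).fun_mul
    (((h1.const_mul k).const_sub 1).fun_add ((hasFDerivAt_snd (𝕜 := ℝ) (p := p)).const_mul A))
  refine HasDerivAt.congr_deriv (h2.hasLineDerivAt v) ?_
  simp
  ring

theorem hasLineDerivAt_barrier_two {n : ℕ} (s k A : ℝ) {p : ExtSpace n} (hp : 0 < p.2)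
    (v : ExtSpace n) :
    HasLineDerivAt ℝ (fun p : ExtSpace n =>
        s * p.2 ^ (s - 1) * v.2 * (1 - k * ‖p.1‖ ^ 2 + A * p.2) +
          p.2 ^ s * (-(2 * k * inner ℝ p.1 v.1) + A * v.2))
      (s * (s - 1) * p.2 ^ (s - 1 - 1) * v.2 ^ 2 * (1 - k * ‖p.1‖ ^ 2 + A * p.2) +
        2 * (s * p.2 ^ (s - 1) * v.2 * (-(2 * k * inner ℝ p.1 v.1) + A * v.2)) -
        2 * k * p.2 ^ s * inner ℝ v.1 v.1) p v := by
  have h1 : HasFDerivAt (fun q : ExtSpace n => ‖q.1‖ ^ 2) _ p :=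
    (hasStrictFDerivAt_norm_sq p.1).hasFDerivAt.comp p hasFDerivAt_fst
  have h2 := (hasFDerivAt_snd_rpow (s - 1) hp).const_mul s |>.mul_const v.2 |>.fun_mul
    (((h1.const_mul k).const_sub 1).fun_add ((hasFDerivAt_snd (𝕜 := ℝ) (p := p)).const_mul A))
  have h3 : HasFDerivAt (fun q : ExtSpace n => inner ℝ q.1 v.1)
      ((innerSL ℝ v.1).comp (ContinuousLinearMap.fst ℝ _ _)) p :=
    ((innerSL ℝ v.1).hasFDerivAt.comp p hasFDerivAt_fst).congr_of_eventuallyEq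
      (Eventually.of_forall fun q => real_inner_comm _ _)
  have h4 := (hasFDerivAt_snd_rpow s hp).fun_mul
    (((h3.const_mul (2 * k)).fun_neg).add_const (A * v.2))
  refine HasDerivAt.congr_deriv ((h2.fun_add h4).hasLineDerivAt v) ?_
  simp
  ring

theorem unitCylinder_snd_pos {n : ℕ} {R : ℝ} : ∀ p ∈ unitCylinder n R, 0 < p.2 :=
  fun _ hp => hp.2.1

theorem closure_unitCylinder {n : ℕ} {R : ℝ} (hR : 0 < R) :
    closure (unitCylinder n R) = Metric.closedBall 0 R ×ˢ Icc (0 : ℝ) 1 := by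
  unfold unitCylinder
  rw [closure_prod_eq, closure_ball _ hR.ne', closure_Ioo zero_ne_one]

theorem ContinuousOn.nonneg_of_mem_closure {X : Type*} [TopologicalSpace X] {s : Set X}
    {f : X → ℝ} (hf : ContinuousOn f (closure s)) (h : ∀ x ∈ s, 0 ≤ f x) {x : X}
    (hx : x ∈ closure s) : 0 ≤ f x := by
  have h1 : f x ∈ closure (f '' s) := hf.image_closure (mem_image_of_mem f hx)
  exact closure_minimal (image_subset_iff.2 h) isClosed_Ici h1

/-- Hopf-type lower bound for positive supersolutions near the bottom of the cylinder. -/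
theorem exists_rpow_le_of_supersolution {n : ℕ} {a : ℝ} (ha : a ∈ Ioo (-1 : ℝ) 1)
    {R : ℝ} (hR : 0 < R) {u : ExtSpace n → ℝ} {Du : ExtSpace n → ExtSpace n}
    (hcont : ContinuousOn u (closure (unitCylinder n R)))
    (hw : IsWeakGradient (unitCylinder n R) u Du)
    (hsuper : IsWeakSupersolution a (unitCylinder n R) Du)
    (hpos : ∀ p ∈ unitCylinder n R, 0 < u p) :
    ∃ c > 0, ∃ h ∈ Ioo (0 : ℝ) 1, ∀ y ∈ Ioo (0 : ℝ) h, c * y ^ (1 - a) ≤ u (0, y) := by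
  obtain ⟨ha1, ha2⟩ := ha
  set r := R / 2 with hr
  have hr0 : 0 < r := by positivity
  -- On the lateral side `1 - k r² + A y ≤ 1 - 2 + A h ≤ 0`, by the choices of `k` and `h`. The
  -- value of `A` makes `A(2-a) - 2nk y ≥ 2 - a` for `y ≤ 1`.
  set k : ℝ := 2 / r ^ 2 with hk
  have hk0 : 0 < k := by positivity
  have hkr : k * r ^ 2 = 2 := by rw [hk]; field_simp
  have ha3 : 0 < 2 - a := by linarith
  set A : ℝ := 2 * n * k / (2 - a) + 1 with hA
  have hA0 : 0 < A := by positivity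
  have hA1 : A * (2 - a) = 2 * n * k + (2 - a) := by rw [hA]; field_simp
  set h : ℝ := 1 / (A + 1) with hh
  have hh0 : 0 < h := by positivity
  have hh1 : h < 1 := by rw [hh, div_lt_one (by positivity)]; linarith
  have hAh : A * h ≤ 1 := by
    rw [hh, mul_one_div, div_le_one (by positivity)]; linarith
  set Q : Set (ExtSpace n) := Metric.closedBall 0 r ×ˢ Icc 0 h with hQ
  set U : Set (ExtSpace n) := Metric.ball 0 r ×ˢ Ioo 0 h with hU
  have hQc : IsCompact Q := (isCompact_closedBall _ _).prod isCompact_Icc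
  have hUo : IsOpen U := Metric.isOpen_ball.prod isOpen_Ioo
  have hrR : r < R := by rw [hr]; linarith
  have hUΩ : U ⊆ unitCylinder n R := prod_mono (Metric.ball_subset_ball hrR.le)
    (Ioo_subset_Ioo_right hh1.le)
  have hQΩ : Q ⊆ closure (unitCylinder n R) := by
    rw [closure_unitCylinder hR]
    exact prod_mono (Metric.closedBall_subset_closedBall hrR.le) (Icc_subset_Icc_right hh1.le)
  have hu0 : ∀ p ∈ Q, 0 ≤ u p := fun p hp =>
    hcont.nonneg_of_mem_closure (fun q hq => (hpos q hq).le) (hQΩ hp)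
  -- lower bound on the top face
  set T : Set (ExtSpace n) := Metric.closedBall 0 r ×ˢ {h} with hT
  have hTΩ : T ⊆ unitCylinder n R := by
    refine prod_mono (Metric.closedBall_subset_ball hrR) ?_
    rintro _ rfl
    exact ⟨hh0, hh1⟩
  have hTc : IsCompact T := (isCompact_closedBall _ _).prod isCompact_singleton
  obtain ⟨pT, hpT, hminT⟩ := hTc.exists_isMinOn
    ⟨(0, h), Metric.mem_closedBall_self hr0.le, rfl⟩ (hcont.mono (hTΩ.trans subset_closure))
  set δ := u pT with hδ
  have hδ0 : 0 < δ := hpos _ (hTΩ hpT)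
  -- On the top face the unscaled barrier is at most `1 + A`, so this scaling keeps `w` below the
  -- minimum `δ` of `u` there.
  set ε : ℝ := δ / (1 + A) with hε
  have hε0 : 0 < ε := by positivity
  have hεA : ε * (1 + A) = δ := by rw [hε]; field_simp
  set w : ExtSpace n → ℝ := fun q => ε * (q.2 ^ (1 - a) * (1 - k * ‖q.1‖ ^ 2 + A * q.2)) with hwd
  have hwc : Continuous w := by
    have : Continuous fun q : ExtSpace n => q.2 ^ (1 - a) :=
      continuous_snd.rpow_const fun q => Or.inr (by linarith)
    fun_prop
  have hbdry : ∀ p ∈ Q, p ∉ U → w p ≤ u p := by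
    rintro ⟨x, y⟩ ⟨hx, hy⟩ hpU
    rw [mem_closedBall_zero_iff] at hx
    simp only at hx hy
    have hy0 : 0 ≤ y ^ (1 - a) := Real.rpow_nonneg hy.1 _
    rcases hy.1.eq_or_lt with h0 | h0
    · have : w (x, y) = 0 := by
        simp only [hwd, ← h0, Real.zero_rpow (by linarith : 1 - a ≠ 0)]
        ring
      rw [this]
      exact hu0 _ ⟨by simpa using hx, hy⟩
    rcases hy.2.eq_or_lt with h1 | h1
    · have hxT : u pT ≤ u (x, y) := hminT (show (x, y) ∈ T from ⟨by simpa using hx, h1⟩)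
      refine le_trans ?_ hxT
      rw [← hδ, ← hεA]
      refine mul_le_mul_of_nonneg_left ?_ hε0.le
      have hy1 : y ^ (1 - a) ≤ 1 := Real.rpow_le_one hy.1 (by linarith) (by linarith)
      have h2 : 1 - k * ‖x‖ ^ 2 + A * y ≤ 1 + A := by
        have : 0 ≤ k * ‖x‖ ^ 2 := by positivity
        have : A * y ≤ A * 1 := mul_le_mul_of_nonneg_left (by linarith) hA0.le
        linarith
      calc y ^ (1 - a) * (1 - k * ‖x‖ ^ 2 + A * y) ≤ y ^ (1 - a) * (1 + A) :=
            mul_le_mul_of_nonneg_left h2 hy0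
        _ ≤ 1 * (1 + A) := mul_le_mul_of_nonneg_right hy1 (by positivity)
        _ = 1 + A := one_mul _
    · have hxr : ‖x‖ = r := by
        by_contra hne
        exact hpU ⟨by simpa using lt_of_le_of_ne hx hne, h0, h1⟩
      refine le_trans ?_ (hu0 _ ⟨by simpa using hx, hy⟩)
      have h2 : 1 - k * ‖x‖ ^ 2 + A * y ≤ 0 := by
        have : A * y ≤ A * h := mul_le_mul_of_nonneg_left hy.2 hA0.le
        rw [hxr, hkr]
        linarith
      exact mul_nonpos_of_nonneg_of_nonpos hε0.le (mul_nonpos_of_nonneg_of_nonpos hy0 h2)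
  have hcomp : ∀ p ∈ Q, w p ≤ u p := by
    by_contra! hcon
    obtain ⟨p₀, hp₀, hlt⟩ := hcon
    -- A positive level, so that the superlevel set `K` stays off the boundary, where `w ≤ u`.
    set m := (w p₀ - u p₀) / 2 with hm
    have hm0 : 0 < m := by rw [hm]; linarith
    have hvc : ContinuousOn (fun p => w p - u p) Q := hwc.continuousOn.sub (hcont.mono hQΩ)
    set K : Set (ExtSpace n) := Q ∩ (fun p => w p - u p) ⁻¹' Ici m with hKd
    have hK : IsCompact K := hQc.of_isClosed_subset
      (hvc.preimage_isClosed_of_isClosed hQc.isClosed isClosed_Ici) inter_subset_left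
    have hKU : K ⊆ U := by
      rintro p ⟨hpQ, hpm⟩
      by_contra hpU
      have h1 := hbdry p hpQ hpU
      have h2 : m ≤ w p - u p := hpm
      linarith
    have hUpos : ∀ p ∈ U, 0 < p.2 := fun p hp => hp.2.1
    have hp₀K : p₀ ∈ K := ⟨hp₀, show m ≤ w p₀ - u p₀ by rw [hm]; linarith⟩
    -- The conjugated operator on the barrier is `ε y^(s-1) (A(2-a) - 2nk y)`; minimizing `y^(s-1)`
    -- over `K` gives a uniform positive bound.
    obtain ⟨pm, hpm, hmin⟩ := hK.exists_isMinOn ⟨p₀, hp₀K⟩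
      (((contDiffOn_snd_rpow (1 - a / 2 - 1) hUpos).continuousOn).mono hKU)
    set s := 1 - a / 2 with hs
    have hBeq : ∀ q ∈ U, q.2 ^ (a / 2) * w q =
        ε * (q.2 ^ s * (1 - k * ‖q.1‖ ^ 2 + A * q.2)) := fun q hq => by
      have : q.2 ^ s = q.2 ^ (a / 2) * q.2 ^ (1 - a) := by
        rw [← Real.rpow_add (hUpos q hq)]
        congr 1
        rw [hs]
        ring
      rw [this]
      simp only [hwd]
      ring
    refine hsuper.not_exists_interior_max (isOpen_unitCylinder n R) unitCylinder_snd_pos hw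
      (hcont.mono subset_closure) hUo hUΩ hK hKU hwc.continuousOn
      (B₁ := fun i q => ε * (s * q.2 ^ (s - 1) * (coordDir n i).2 *
        (1 - k * ‖q.1‖ ^ 2 + A * q.2) + q.2 ^ s *
          (-(2 * k * inner ℝ q.1 (coordDir n i).1) + A * (coordDir n i).2)))
      (B₂ := fun i q => ε * (s * (s - 1) * q.2 ^ (s - 1 - 1) * (coordDir n i).2 ^ 2 *
        (1 - k * ‖q.1‖ ^ 2 + A * q.2) + 2 * (s * q.2 ^ (s - 1) * (coordDir n i).2 *
          (-(2 * k * inner ℝ q.1 (coordDir n i).1) + A * (coordDir n i).2)) -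
        2 * k * q.2 ^ s * inner ℝ (coordDir n i).1 (coordDir n i).1))
      ?_ ?_ (c := ε * ((2 - a) * pm.2 ^ (s - 1))) ?_ ?_ hp₀K (m := m) ?_ ?_
    · intro i p hp
      refine ((hasLineDerivAt_barrier s k A (hUpos p hp) (coordDir n i)).const_mul_real
        ε).congr_of_eventuallyEq ?_
      filter_upwards [hUo.mem_nhds hp] with q hq using hBeq q hq
    · intro i p hp
      exact (hasLineDerivAt_barrier_two s k A (hUpos p hp) (coordDir n i)).const_mul_real ε
    · have := Real.rpow_pos_of_pos (hUpos pm (hKU hpm)) (s - 1)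
      positivity
    · intro p hp
      have hp2 := hUpos p (hKU hp)
      have hple : p.2 ≤ 1 := (hKU hp).2.2.le.trans hh1.le
      have hmp : pm.2 ^ (s - 1) ≤ p.2 ^ (s - 1) := hmin hp
      rw [hBeq p (hKU hp), ← Finset.mul_sum, Fintype.sum_option]
      have e1 : p.2 ^ s = p.2 ^ (s - 1) * p.2 := by
        rw [← Real.rpow_add_one hp2.ne']
        ring_nf
      have e2 : p.2 ^ (s - 1 - 1) = p.2 ^ (s - 1) * p.2⁻¹ := by
        rw [← Real.rpow_neg_one, ← Real.rpow_add hp2]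
        ring_nf
      have e3 : ∀ i : Fin n, inner ℝ (EuclideanSpace.single i (1 : ℝ))
          (EuclideanSpace.single i (1 : ℝ)) = 1 := fun i => by
        simp
      simp only [coordDir, inner_zero_right, e3, e1, e2, mul_zero, zero_mul, Finset.sum_const,
        Finset.card_univ, Fintype.card_fin, nsmul_eq_mul, one_pow, mul_one, neg_zero, zero_add,
        sub_zero, ne_eq, OfNat.ofNat_ne_zero, not_false_eq_true, zero_pow, add_zero]
      have hkey : ε * ((2 - a) * pm.2 ^ (s - 1)) ≤
          ε * (p.2 ^ (s - 1) * (A * (2 - a) - 2 * n * k * p.2)) := by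
        refine mul_le_mul_of_nonneg_left ?_ hε0.le
        have h1 : 2 - a ≤ A * (2 - a) - 2 * n * k * p.2 := by
          have : 2 * n * k * p.2 ≤ 2 * n * k * 1 :=
            mul_le_mul_of_nonneg_left hple (by positivity)
          linarith
        calc (2 - a) * pm.2 ^ (s - 1) ≤ (2 - a) * p.2 ^ (s - 1) :=
              mul_le_mul_of_nonneg_left hmp ha3.le
          _ ≤ (A * (2 - a) - 2 * n * k * p.2) * p.2 ^ (s - 1) :=
              mul_le_mul_of_nonneg_right h1 (Real.rpow_nonneg hp2.le _)
          _ = _ := mul_comm _ _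
      refine hkey.trans_eq ?_
      rw [hs]
      field_simp
      ring
    · show m < w p₀ - u p₀
      rw [hm]
      linarith
    · intro p hp hpK
      by_contra! hlt'
      exact hpK ⟨prod_mono Metric.ball_subset_closedBall Ioo_subset_Icc_self hp, hlt'.le⟩
  refine ⟨ε, hε0, h, ⟨hh0, hh1⟩, fun y hy => ?_⟩
  refine le_trans ?_ (hcomp (0, y) ⟨Metric.mem_closedBall_self hr0.le, hy.1.le, hy.2.le⟩)
  simp only [hwd, norm_zero]
  refine mul_le_mul_of_nonneg_left ?_ hε0.le
  have h1 : 0 ≤ y ^ (1 - a) := Real.rpow_nonneg hy.1.le _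
  have h2 : 0 ≤ y ^ (1 - a) * (A * y) := mul_nonneg h1 (mul_nonneg hA0.le hy.1.le)
  linarith

/-! ### From weak to classical derivatives -/

/-- A continuous function with a continuous weak directional derivative has it as a classical
directional derivative. -/
theorem hasLineDerivAt_of_weak {n : ℕ} {Ω : Set (ExtSpace n)} (hΩ : IsOpen Ω)
    {u G : ExtSpace n → ℝ} (hu : ContinuousOn u Ω) (hG : ContinuousOn G Ω) {v : ExtSpace n}
    (hweak : ∀ ξ : ExtSpace n → ℝ, IsTestFunction Ω ξ →
      ∫ p in Ω, u p * fderiv ℝ ξ p v = -∫ p in Ω, G p * ξ p)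
    {p : ExtSpace n} (hp : p ∈ Ω) : HasLineDerivAt ℝ u (G p) p v := by
  obtain ⟨d, hd, χ, hχc, hχs, hχU, hχ1⟩ :=
    exists_cutoff (isCompact_singleton (x := p)) hΩ (singleton_subset_iff.2 hp)
  replace hχ1 : ∀ q, dist q p ≤ d → q ∈ Ω ∧ χ q = 1 := fun q hq => hχ1 p rfl q hq
  have hu' : Continuous fun q => χ q * u q := hu.continuous_mul_of_tsupport_subset hΩ hχc hχU
  have hG' : Continuous fun q => χ q * G q := hG.continuous_mul_of_tsupport_subset hΩ hχc hχU
  have hr : ∀ k : ℕ, 0 < d / 2 / ((k : ℝ) + 1) := fun k => by positivity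
  have hrd : ∀ k : ℕ, d / 2 / ((k : ℝ) + 1) ≤ d / 2 := fun k =>
    div_le_self (by positivity) (by linarith [(Nat.cast_nonneg k : (0 : ℝ) ≤ k)])
  let φ : ℕ → ContDiffBump (0 : ExtSpace n) := fun k =>
    ⟨d / 2 / ((k : ℝ) + 1) / 2, d / 2 / ((k : ℝ) + 1), half_pos (hr k), half_lt_self (hr k)⟩
  have hφ0 : Tendsto (fun k => (φ k).rOut) atTop (𝓝 0) := by
    have : Tendsto (fun k : ℕ => d / 2 * (1 / ((k : ℝ) + 1))) atTop (𝓝 (d / 2 * 0)) :=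
      tendsto_one_div_add_atTop_nhds_zero_nat.const_mul _
    simpa [φ, div_eq_mul_inv] using this
  have hclose : ∀ g : ExtSpace n → ℝ, Continuous g → HasCompactSupport g → ∀ κ > 0,
      ∀ᶠ k in atTop, ∀ q, |(∫ r, (φ k).normed volume (q - r) * g r) - g q| < κ := by
    intro g hg hgs κ hκ
    obtain ⟨e, he, H⟩ := exists_mollification_close (μ := volume) hg hgs (half_pos hκ)
    filter_upwards [hφ0.eventually (ge_mem_nhds he)] with k hk q
    exact (H (φ k) hk q).trans_lt (half_lt_self hκ)
  have hline : Continuous fun t : ℝ => p + t • v := by fun_prop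
  set S : Set ℝ := (fun t : ℝ => p + t • v) ⁻¹' Metric.ball p (d / 2) with hS
  have hSo : IsOpen S := Metric.isOpen_ball.preimage hline
  have h0S : (0 : ℝ) ∈ S := by simp [hS, hd]
  -- Near `p` on the line, the derivative of the mollified `χ u` is the mollified `χ G`; uniform
  -- convergence of these derivatives passes to the limit.
  have hmain : HasDerivAt (fun t : ℝ => χ (p + t • v) * u (p + t • v))
      (χ (p + (0 : ℝ) • v) * G (p + (0 : ℝ) • v)) 0 := by
    refine hasDerivAt_of_tendstoUniformlyOn (l := atTop) (s := S)
      (g' := fun t : ℝ => χ (p + t • v) * G (p + t • v))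
      (f := fun k t => ∫ r, (φ k).normed volume (p + t • v - r) * (χ r * u r))
      (f' := fun k t => ∫ r, (φ k).normed volume (p + t • v - r) * (χ r * G r))
      hSo ?_ ?_ ?_ h0S
    · rw [Metric.tendstoUniformlyOn_iff]
      intro κ hκ
      filter_upwards [hclose _ hG' hχs.mul_right κ hκ] with k hk t _
      rw [dist_comm, Real.dist_eq]
      exact hk _
    · refine Eventually.of_forall fun k t ht => ?_
      have hD := hasDerivAt_integral_sub_mul (μ := volume) (ρ := (φ k).normed volume)
        ((φ k).contDiff_normed (n := 1)) (φ k).hasCompactSupport_normed hu' p v t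
      refine hD.congr_deriv ?_
      set q := p + t • v with hq
      have hball : ∀ r ∈ Metric.closedBall q (φ k).rOut, r ∈ Ω ∧ χ r = 1 := by
        intro r hr
        refine hχ1 r ((dist_triangle r q p).trans ?_)
        have h1 : dist r q ≤ d / 2 := (Metric.mem_closedBall.1 hr).trans (hrd k)
        have h2 : dist q p < d / 2 := ht
        linarith
      have htest := isTestFunction_normed_const_sub (φ k) (p := q)
        (fun r hr => (hball r hr).1)
      have hw := hweak _ htest
      have hdiff : Differentiable ℝ ((φ k).normed volume) :=
        ((φ k).contDiff_normed (n := 1)).differentiable (by simp)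
      rw [setIntegral_eq_integral_of_forall_compl_eq_zero,
        setIntegral_eq_integral_of_forall_compl_eq_zero] at hw
      · have e1 : ∫ r, u r * fderiv ℝ (fun r => (φ k).normed volume (q - r)) r v =
            -∫ r, fderiv ℝ ((φ k).normed volume) (q - r) v * (χ r * u r) := by
          rw [← integral_neg]
          refine integral_congr_ae (Eventually.of_forall fun r => ?_)
          dsimp only
          rw [fderiv_const_sub_apply hdiff]
          by_cases hr : r ∈ Metric.closedBall q (φ k).rOut
          · rw [(hball r hr).2]
            ring
          · rw [EventuallyEq.fderiv_eq (normed_eventuallyEq_zero (φ k) hr)]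
            simp
        have e2 : ∫ r, G r * (φ k).normed volume (q - r) =
            ∫ r, (φ k).normed volume (q - r) * (χ r * G r) := by
          refine integral_congr_ae (Eventually.of_forall fun r => ?_)
          dsimp only
          by_cases hr : r ∈ Metric.closedBall q (φ k).rOut
          · rw [(hball r hr).2]
            ring
          · rw [(normed_eventuallyEq_zero (φ k) hr).self_of_nhds]
            simp
        rw [e1, e2] at hw
        exact neg_injective hw
      · intro r hr
        rw [(normed_eventuallyEq_zero (φ k) fun h => hr (hball r h).1).self_of_nhds]
        simp
      · intro r hr
        rw [fderiv_const_sub_apply hdiff, EventuallyEq.fderiv_eq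
          (normed_eventuallyEq_zero (φ k) fun h => hr (hball r h).1)]
        simp
    · intro t _
      rw [Metric.tendsto_nhds]
      intro κ hκ
      filter_upwards [hclose _ hu' hχs.mul_right κ hκ] with k hk
      rw [Real.dist_eq]
      exact hk _
  have hGp : χ (p + (0 : ℝ) • v) * G (p + (0 : ℝ) • v) = G p := by
    rw [zero_smul, add_zero, (hχ1 p (by simp [hd.le])).2, one_mul]
  rw [hGp] at hmain
  refine hmain.congr_of_eventuallyEq ?_
  filter_upwards [hSo.mem_nhds h0S] with t ht
  have h2 : dist (p + t • v) p < d / 2 := ht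
  rw [(hχ1 (p + t • v) (by linarith)).2, one_mul]

/-- If `y^a u_y` is a.e. equal to a continuous `g`, then `u_y = y^(-a) g` classically. -/
theorem IsWeakGradient.hasDerivAt_snd {n : ℕ} {a : ℝ} {Ω : Set (ExtSpace n)} (hΩ : IsOpen Ω)
    (hΩpos : ∀ p ∈ Ω, 0 < p.2) {u g : ExtSpace n → ℝ} {Du : ExtSpace n → ExtSpace n}
    (hw : IsWeakGradient Ω u Du) (hu : ContinuousOn u Ω) (hg : ContinuousOn g Ω)
    (hae : g =ᵐ[volume.restrict Ω] fun p => p.2 ^ a * (Du p).2)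
    {x : EuclideanSpace ℝ (Fin n)} {y : ℝ} (hxy : (x, y) ∈ Ω) :
    HasDerivAt (fun t : ℝ => u (x, t)) (y ^ (-a) * g (x, y)) y := by
  have h : HasLineDerivAt ℝ u (y ^ (-a) * g (x, y)) (x, y) ((0, 1) : ExtSpace n) := by
    refine hasLineDerivAt_of_weak (G := fun p => p.2 ^ (-a) * g p) hΩ hu
      ((contDiffOn_snd_rpow _ hΩpos).continuousOn.mul hg) (fun ξ hξ => ?_) hxy
    rw [hw.integral_eq ξ hξ]
    congr 1
    refine integral_congr_ae ?_
    filter_upwards [hae, ae_restrict_mem hΩ.measurableSet] with p hp hpΩ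
    rw [hp, ← mul_assoc, ← Real.rpow_add (hΩpos p hpΩ)]
    simp [dotExt]
  have h' : HasDerivAt (fun s : ℝ => u ((x, y) + s • ((0, 1) : ExtSpace n)))
      (y ^ (-a) * g (x, y)) (y - y) := by
    rw [sub_self]
    exact h
  refine (h'.comp_sub_const y y).congr_of_eventuallyEq (Eventually.of_forall fun t => ?_)
  simp

/-! ### The conormal derivative -/

theorem proposition4p8 (n : ℕ) (hn : 1 ≤ n) (a : ℝ) (ha : a ∈ Set.Ioo (-1 : ℝ) 1)
    (R : ℝ) (hR : 0 < R)
    (u : ExtSpace n → ℝ) (Du : ExtSpace n → ExtSpace n)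
    (hcont : ContinuousOn u (closure (unitCylinder n R)))
    (hH1 : MemWeightedH1 a (unitCylinder n R) u Du)
    (hsuper : IsWeakSupersolution a (unitCylinder n R) Du)
    (hpos : ∀ p ∈ unitCylinder n R, 0 < u p)
    (hzero : u (0, 0) = 0) :
    Filter.limsup (fun y : ℝ => ((-(y ^ a * (u (0, y) / y)) : ℝ) : EReal)) (𝓝[>] 0) < 0 ∧
    ∀ g : ExtSpace n → ℝ, ContinuousOn g (closure (unitCylinder n R)) →
      g =ᵐ[volume.restrict (unitCylinder n R)] (fun p => p.2 ^ a * (Du p).2) →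
      HasConormalDerivAt a u 0 (-g (0, 0)) ∧ -g (0, 0) < 0 := by
  have hw := hH1.isWeakGradient
  obtain ⟨c, hc, h, ⟨hh0, hh1⟩, hlow⟩ := exists_rpow_le_of_supersolution ha hR hcont hw hsuper hpos
  have ha2 : 0 < 1 - a := by linarith [ha.2]
  constructor
  · refine lt_of_le_of_lt (b := ((-c : ℝ) : EReal)) ?_ (by exact_mod_cast neg_lt_zero.2 hc)
    refine limsup_le_of_le (h := ?_)
    filter_upwards [Ioo_mem_nhdsGT hh0] with y hy
    have hb := hlow y hy
    have hya : 0 < y ^ a := Real.rpow_pos_of_pos hy.1 a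
    have e : y ^ a * (c * y ^ (1 - a) / y) = c := by
      rw [Real.rpow_sub hy.1, Real.rpow_one]
      have := hy.1.ne'
      field_simp
    have : c ≤ y ^ a * (u (0, y) / y) := by
      conv_lhs => rw [← e]
      exact mul_le_mul_of_nonneg_left (div_le_div_of_nonneg_right hb hy.1.le) hya.le
    exact EReal.coe_le_coe_iff.2 (neg_le_neg this)
  · intro g hg hae
    have hmem : ∀ y ∈ Ioo (0 : ℝ) 1, ((0, y) : ExtSpace n) ∈ unitCylinder n R := fun y hy =>
      ⟨Metric.mem_ball_self hR, hy⟩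
    have hder : ∀ y ∈ Ioo (0 : ℝ) 1,
        HasDerivAt (fun t : ℝ => u (0, t)) (y ^ (-a) * g (0, y)) y := fun y hy =>
      hw.hasDerivAt_snd (isOpen_unitCylinder n R) unitCylinder_snd_pos
        (hcont.mono subset_closure) (hg.mono subset_closure) hae (hmem y hy)
    have hcl : ∀ y ∈ Icc (0 : ℝ) 1, ((0, y) : ExtSpace n) ∈ closure (unitCylinder n R) := by
      intro y hy
      rw [closure_unitCylinder hR]
      exact ⟨Metric.mem_closedBall_self hR.le, hy⟩
    have hgc : ContinuousOn (fun y : ℝ => g (0, y)) (Icc 0 1) :=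
      hg.comp (by fun_prop : Continuous fun y : ℝ => ((0, y) : ExtSpace n)).continuousOn hcl
    have huc : ContinuousOn (fun y : ℝ => u (0, y)) (Icc 0 1) :=
      hcont.comp (by fun_prop : Continuous fun y : ℝ => ((0, y) : ExtSpace n)).continuousOn hcl
    have hglim : Tendsto (fun y : ℝ => g (0, y)) (𝓝[>] 0) (𝓝 (g (0, 0))) := by
      have h1 : Tendsto (fun y : ℝ => g (0, y)) (𝓝[Icc 0 1] 0) (𝓝 (g (0, 0))) :=
        hgc 0 (left_mem_Icc.2 zero_le_one)
      refine h1.mono_left ?_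
      rw [← nhdsWithin_Ioo_eq_nhdsGT (zero_lt_one' ℝ)]
      exact nhdsWithin_mono _ Ioo_subset_Icc_self
    refine ⟨⟨?_, ?_⟩, ?_⟩
    · filter_upwards [Ioo_mem_nhdsGT (zero_lt_one' ℝ)] with y hy
      exact (hder y hy).differentiableAt
    · refine hglim.neg.congr' ?_
      filter_upwards [Ioo_mem_nhdsGT (zero_lt_one' ℝ)] with y hy
      rw [(hder y hy).deriv, ← mul_assoc, ← Real.rpow_add hy.1]
      simp
    · by_contra! hcon
      have hev : ∀ᶠ y in 𝓝[>] (0 : ℝ), g (0, y) < c / 2 * (1 - a) :=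
        hglim.eventually (gt_mem_nhds (lt_of_le_of_lt (neg_nonneg.1 hcon) (by positivity)))
      obtain ⟨η, hη0, hη⟩ := mem_nhdsGT_iff_exists_Ioo_subset.1 hev
      obtain ⟨y₁, hy0, hy1⟩ := exists_between (lt_min hh0 hη0 : (0 : ℝ) < min h η)
      have hy1h : y₁ < h := hy1.trans_le (min_le_left _ _)
      have hy1η : y₁ < η := hy1.trans_le (min_le_right _ _)
      -- Its derivative is `y^(-a) (c(1-a)/2 - g(0,y)) ≥ 0`, and it vanishes at `0`; hence `u(0,y₁)
      -- ≤ (c/2) y₁^(1-a)`, half of the lower bound.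
      have hmono : MonotoneOn (fun y : ℝ => c / 2 * y ^ (1 - a) - u (0, y)) (Icc 0 y₁) := by
        have hD : ∀ y ∈ Ioo 0 y₁, HasDerivAt (fun y : ℝ => c / 2 * y ^ (1 - a) - u (0, y))
            (c / 2 * ((1 - a) * y ^ (1 - a - 1)) - y ^ (-a) * g (0, y)) y := fun y hy =>
          ((Real.hasDerivAt_rpow_const (Or.inl hy.1.ne')).const_mul (c / 2)).sub
            (hder y ⟨hy.1, by linarith [hy.2]⟩)
        refine monotoneOn_of_deriv_nonneg (convex_Icc 0 y₁) ?_ ?_ ?_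
        · refine ContinuousOn.sub ?_ (huc.mono (Icc_subset_Icc_right (by linarith)))
          exact (continuous_const.mul
            (Real.continuous_rpow_const ha2.le)).continuousOn
        · rw [interior_Icc]
          exact fun y hy => (hD y hy).differentiableAt.differentiableWithinAt
        · rw [interior_Icc]
          intro y hy
          rw [(hD y hy).deriv, show 1 - a - 1 = -a by ring]
          have hgy : g (0, y) < c / 2 * (1 - a) := hη ⟨hy.1, by linarith [hy.2]⟩
          have := mul_le_mul_of_nonneg_left hgy.le (Real.rpow_nonneg hy.1.le (-a))
          linarith
      have hle := hmono (left_mem_Icc.2 hy0.le) (right_mem_Icc.2 hy0.le) hy0.le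
      simp only [hzero, Real.zero_rpow ha2.ne'] at hle
      have h1 := hlow y₁ ⟨hy0, hy1h⟩
      have h2 : 0 < c * y₁ ^ (1 - a) := mul_pos hc (Real.rpow_pos_of_pos hy0 _)
      linarith
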